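/- Let $k \ge 1$ and $n \ge 2k$ be integers, and let $\mathcal{A}, \mathcal{B} \subset \binom{[n]}{k}$ be two disjoint families of $k$-element subsets of $[n] = \{1, \dots, n\}$ that are cross-intersecting, that is, $A \cap B \neq \emptyset$ for every $A \in \mathcal{A}$ and every $B \in \mathcal{B}$. Then $$\min\{|\mathcal{A}|, |\mathcal{B}|\} \le \frac{1}{2}\binom{n-1}{k-1} \cdot \frac{n-2}{n-k-1},$$ where in the degenerate case $n = 2$, $k = 1$ the quotient $\frac{n-2}{n-k-1}$ is read as $0$. -/

import Mathlib

/-- Two families of finite sets are cross-intersecting if every member of the first one meets every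
member of the second one. -/
def CrossIntersecting {α : Type*} [DecidableEq α] (𝒜 ℬ : Finset (Finset α)) : Prop :=
  ∀ A ∈ 𝒜, ∀ B ∈ ℬ, (A ∩ B).Nonempty

/-!
The bound is a ratio bound for the Kneser graph on the `k`-subsets of an `n`-set, with adjacency
operator `M`. Let `f` and `g` be the indicators of the two families. Cross-intersection says
`⟪f, M g⟫ = 0` and disjointness says `⟪f, g⟫ = 0`, so `⟪f, (M + t I) g⟫ = 0` for every real `t`: one
may shift the spectrum of `M` before estimating.

The eigenvalues of `M` are `(-1) ^ j * (n - k - j).choose (k - j)` for `j ≤ k`, the value `j = 0`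
belonging to the constants. For `k ≥ 2` (the case `k = 1` is immediate), the others lie between `-C₁` and `C₂`, where
`C₁ = (n - k - 1).choose (k - 1)` and `C₂ = (n - k - 2).choose (k - 2)`. With `t = (C₁ - C₂) / 2`
this interval is centred at `0` and has radius `R = (C₁ + C₂) / 2`. Subtracting a multiple `c J` of
the all-ones operator moves the eigenvalue of the constants to `-R` as well. For families of the same
size `m` this gives `c * m ^ 2 = -⟪f, (M + t I - c J) g⟫ ≤ R * m`, and `R / c` is the claimed bound.

The spectrum is found by lifting harmonic functions (`shiftedKneser_upOperator`), which are
eigenvectors by the sign rule `IsHarmonic.sum_disjoint`. That they account for everything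
(`iSup_eigenspace_shiftedKneser`) follows by splitting a function at level `j` orthogonally into a
harmonic part and a part lifted from lower levels. No distinctness of the eigenvalues is needed.
-/

open Finset

/-! ### Symmetric operators with bounded spectrum -/

theorem abs_inner_self_le_of_eigenvalues {E : Type*} [NormedAddCommGroup E] [InnerProductSpace ℝ E]
    [FiniteDimensional ℝ E] {T : E →ₗ[ℝ] E} (hT : T.IsSymmetric) {R : ℝ}
    (hR : ∀ μ, Module.End.HasEigenvalue T μ → |μ| ≤ R) (f : E) :
    |inner ℝ f (T f)| ≤ R * ‖f‖ ^ 2 := by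
  have h1 : inner ℝ f (T f) =
      ∑ i, hT.eigenvalues rfl i * (inner ℝ (hT.eigenvectorBasis rfl i) f) ^ 2 := by
    rw [← (hT.eigenvectorBasis rfl).sum_inner_mul_inner f (T f)]
    refine sum_congr rfl fun i _ => ?_
    rw [← hT, hT.apply_eigenvectorBasis, inner_smul_left, real_inner_comm]
    simp only [conj_trivial, RCLike.ofReal_real_eq_id, id]
    ring
  rw [h1, ← (hT.eigenvectorBasis rfl).sum_sq_norm_inner_right f, mul_sum]
  refine (abs_sum_le_sum_abs _ _).trans (sum_le_sum fun i _ => ?_)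
  rw [abs_mul, Real.norm_eq_abs, sq_abs, abs_of_nonneg (sq_nonneg (inner ℝ _ f))]
  exact mul_le_mul_of_nonneg_right (hR _ (hT.hasEigenvalue_eigenvalues rfl i)) (sq_nonneg _)

theorem abs_inner_le_of_eigenvalues {E : Type*} [NormedAddCommGroup E] [InnerProductSpace ℝ E]
    [FiniteDimensional ℝ E] {T : E →ₗ[ℝ] E} (hT : T.IsSymmetric) {R : ℝ}
    (hR : ∀ μ, Module.End.HasEigenvalue T μ → |μ| ≤ R) (f g : E) :
    |inner ℝ f (T g)| ≤ R / 2 * (‖f‖ ^ 2 + ‖g‖ ^ 2) := by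
  have h1 := abs_le.1 (abs_inner_self_le_of_eigenvalues hT hR (f + g))
  have h2 := abs_le.1 (abs_inner_self_le_of_eigenvalues hT hR (f - g))
  have h3 : inner ℝ g (T f) = inner ℝ f (T g) := by rw [← hT, real_inner_comm]
  have h4 := parallelogram_law_with_norm ℝ f g
  simp only [map_add, map_sub, inner_add_left, inner_add_right, inner_sub_left, inner_sub_right,
    h3] at h1 h2
  have h5 : R * ‖f + g‖ ^ 2 + R * ‖f - g‖ ^ 2 = 2 * R * (‖f‖ ^ 2 + ‖g‖ ^ 2) := by
    linear_combination R * h4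
  rw [abs_le]
  constructor <;> linarith [h1.1, h1.2, h2.1, h2.2]

/-- If the eigenspaces with eigenvalue in `S` span, there is no eigenvalue outside `S`. -/
theorem mem_of_hasEigenvalue_of_iSup_eigenspace_eq_top {E : Type*} [AddCommGroup E] [Module ℝ E]
    {T : Module.End ℝ E} {S : Set ℝ} (h : ⨆ μ ∈ S, T.eigenspace μ = ⊤) {ν : ℝ}
    (hν : T.HasEigenvalue ν) : ν ∈ S := by
  by_contra hS
  have hd := T.eigenspaces_iSupIndep.disjoint_biSup hS
  rw [h, disjoint_top] at hd
  exact hν hd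

/-! ### Functions on the levels of the Boolean lattice -/

variable {α : Type*}

/-- The inclusion operator from level `j` to level `k` of the Boolean lattice: the value of the image
of `h` at a `k`-set is the sum of `h` over its `j`-subsets. Functions on a level are encoded as
functions on all finite sets, and the image is extended by `0` off level `k`. -/
def upOperator (j k : ℕ) :
    EuclideanSpace ℝ (Finset α) →ₗ[ℝ] EuclideanSpace ℝ (Finset α) where
  toFun h := WithLp.toLp 2 fun A => if #A = k then ∑ I ∈ A.powersetCard j, h I else 0
  map_add' f g := by
    ext A
    by_cases hA : #A = k <;> simp [hA, sum_add_distrib]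
  map_smul' r f := by
    ext A
    by_cases hA : #A = k <;> simp [hA, mul_sum]

theorem upOperator_apply (j k : ℕ) (h : EuclideanSpace ℝ (Finset α)) (A : Finset α) :
    upOperator j k h A = if #A = k then ∑ I ∈ A.powersetCard j, h I else 0 := rfl

variable [Fintype α] [DecidableEq α]

/-- The operator `M + t I - c J` on functions on the `k`-sets, where `M` is the adjacency operator of
the Kneser graph and `J` is the all-ones operator. On functions on all finite sets, it ignores the
values off level `k` and returns `0` there. -/
def shiftedKneser (k : ℕ) (t c : ℝ) :
    EuclideanSpace ℝ (Finset α) →ₗ[ℝ] EuclideanSpace ℝ (Finset α) where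
  toFun f := WithLp.toLp 2 fun A =>
    if #A = k then
      ∑ B ∈ powersetCard k univ, ((if Disjoint A B then 1 else 0) - c) * f B + t * f A
    else 0
  map_add' f g := by
    ext A
    by_cases hA : #A = k
    · simp [hA, mul_add, sum_add_distrib]; ring
    · simp [hA]
  map_smul' r f := by
    ext A
    by_cases hA : #A = k
    · simp [hA, mul_add, mul_sum, mul_left_comm]
    · simp [hA]

theorem shiftedKneser_apply (k : ℕ) (t c : ℝ) (f : EuclideanSpace ℝ (Finset α)) (A : Finset α) :
    shiftedKneser k t c f A = if #A = k then
      ∑ B ∈ powersetCard k univ, ((if Disjoint A B then 1 else 0) - c) * f B + t * f A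
    else 0 := rfl

theorem inner_shiftedKneser (k : ℕ) (t c : ℝ) (f g : EuclideanSpace ℝ (Finset α)) :
    inner ℝ f (shiftedKneser k t c g) =
      ∑ A ∈ powersetCard k univ, ∑ B ∈ powersetCard k univ,
        ((if Disjoint A B then 1 else 0) - c) * (f A * g B) +
      t * ∑ A ∈ powersetCard k univ, f A * g A := by
  have : (powersetCard k univ : Finset (Finset α)) = univ.filter (fun A => #A = k) := by
    ext; simp [mem_powersetCard]
  rw [PiLp.inner_apply, mul_sum, ← sum_add_distrib]
  conv_rhs => rw [this, sum_filter]
  refine sum_congr rfl fun A _ => ?_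
  rw [shiftedKneser_apply]
  split_ifs with hA
  · simp only [RCLike.inner_apply, conj_trivial, add_mul, sum_mul, this]
    congr 1
    · exact sum_congr rfl fun B _ => by ring
    · ring
  · simp

theorem isSymmetric_shiftedKneser (k : ℕ) (t c : ℝ) :
    (shiftedKneser (α := α) k t c).IsSymmetric := by
  intro f g
  rw [real_inner_comm, inner_shiftedKneser, inner_shiftedKneser, sum_comm]
  simp only [disjoint_comm, mul_comm]

/-! ### Harmonic functions and the Kneser spectrum -/

/-- A function is harmonic at level `j` if its sum over the `j`-sets containing `J` vanishes for
every `J` with fewer than `j` elements, that is, if its restriction to level `j` is orthogonal to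
everything lifted from lower levels. Its values off level `j` are irrelevant. -/
def IsHarmonic (j : ℕ) (g : EuclideanSpace ℝ (Finset α)) : Prop :=
  ∀ J : Finset α, #J < j → ∑ I ∈ powersetCard j univ with J ⊆ I, g I = 0

/-- For a harmonic function, passing from the `j`-subsets of `A` to the `j`-subsets of the complement
of `A` only changes the sum by the sign `(-1) ^ j`: in the inclusion-exclusion over the subsets `J`
of `A`, the terms with `#J < j` vanish by harmonicity and those with `#J = j` are single values. -/
theorem IsHarmonic.sum_disjoint {j : ℕ} {g : EuclideanSpace ℝ (Finset α)} (hg : IsHarmonic j g)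
    (A : Finset α) :
    ∑ I ∈ powersetCard j univ with Disjoint A I, g I = (-1) ^ j * ∑ I ∈ A.powersetCard j, g I := by
  have h1 : ∀ I : Finset α, (if Disjoint A I then g I else 0) =
      ∑ J ∈ A.powerset, if J ⊆ I then (-1 : ℝ) ^ #J * g I else 0 := by
    intro I
    have := congrArg (Int.cast : ℤ → ℝ) (sum_powerset_neg_one_pow_card (x := A ∩ I))
    rw [← sum_filter, ← sum_mul]
    have h2 : A.powerset.filter (· ⊆ I) = (A ∩ I).powerset := by
      ext J; rw [mem_filter, mem_powerset, mem_powerset, subset_inter_iff]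
    rw [h2]
    push_cast at this
    rw [this]
    simp [disjoint_iff_inter_eq_empty]
  rw [sum_filter, sum_congr rfl fun I _ => h1 I, sum_comm, mul_sum]
  have h3 : A.powersetCard j ⊆ A.powerset := fun J hJ => by
    simp only [mem_powersetCard, mem_powerset] at hJ ⊢; exact hJ.1
  rw [← sum_subset h3]
  · refine sum_congr rfl fun J hJ => ?_
    rw [mem_powersetCard] at hJ
    rw [sum_eq_single J]
    · simp [hJ.2]
    · intro I hI hIJ
      rw [if_neg fun h => hIJ (eq_of_subset_of_card_le h ?_).symm]
      rw [(mem_powersetCard.1 hI).2, hJ.2]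
    · simp [mem_powersetCard, hJ.2]
  · intro J hJ hJ'
    rw [mem_powerset] at hJ
    have hne : #J ≠ j := fun h => hJ' (mem_powersetCard.2 ⟨hJ, h⟩)
    rcases lt_or_gt_of_ne hne with h | h
    · rw [← sum_filter, ← mul_sum, hg J h, mul_zero]
    · refine sum_eq_zero fun I hI => if_neg fun hJI => ?_
      have := card_le_card hJI
      rw [(mem_powersetCard.1 hI).2] at this
      omega

theorem sum_sum_powersetCard {α : Type*} [DecidableEq α] {j k : ℕ} (hjk : j ≤ k) (X : Finset α)
    (g : Finset α → ℝ) :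
    ∑ B ∈ X.powersetCard k, ∑ I ∈ B.powersetCard j, g I =
      ((#X - j).choose (k - j) : ℝ) * ∑ I ∈ X.powersetCard j, g I := by
  rw [sum_comm' (t' := X.powersetCard j) (s' := fun I => {B ∈ X.powersetCard k | I ⊆ B})]
  · rw [mul_sum]
    refine sum_congr rfl fun I hI => ?_
    rw [mem_powersetCard] at hI
    rw [sum_const, nsmul_eq_mul, card_filter_powersetCard_subset _ _ _ hI.1 (hI.2.le.trans hjk), hI.2]
  · intro B I
    simp only [mem_powersetCard, mem_filter]
    constructor
    · rintro ⟨⟨h1, h2⟩, h3, h4⟩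
      exact ⟨⟨⟨h1, h2⟩, h3⟩, h3.trans h1, h4⟩
    · rintro ⟨⟨⟨h1, h2⟩, h3⟩, -, h4⟩
      exact ⟨⟨h1, h2⟩, h3, h4⟩

theorem upOperator_comp {α : Type*} [DecidableEq α] {i j k : ℕ} (hij : i ≤ j)
    (h : EuclideanSpace ℝ (Finset α)) :
    upOperator j k (upOperator i j h) = ((k - i).choose (j - i) : ℝ) • upOperator i k h := by
  ext A
  simp only [upOperator_apply, PiLp.smul_apply, smul_eq_mul]
  split_ifs with hA
  · rw [← hA, ← sum_sum_powersetCard hij]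
    exact sum_congr rfl fun B hB => if_pos (mem_powersetCard.1 hB).2
  · simp

/-- The lift to level `k` of a harmonic function at level `j` is an eigenvector. -/
theorem shiftedKneser_upOperator {j k : ℕ} (hjk : j ≤ k) (t c : ℝ)
    {g : EuclideanSpace ℝ (Finset α)} (hg : IsHarmonic j g) :
    shiftedKneser k t c (upOperator j k g) =
      ((-1) ^ j * ((Fintype.card α - k - j).choose (k - j) : ℝ) + t -
        if j = 0 then c * (Fintype.card α).choose k else 0) • upOperator j k g := by
  ext A
  rw [shiftedKneser_apply, PiLp.smul_apply, smul_eq_mul]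
  by_cases hA : #A = k
  swap
  · simp [upOperator_apply, hA]
  have hup : ∀ B ∈ (powersetCard k univ : Finset (Finset α)),
      upOperator j k g B = ∑ I ∈ B.powersetCard j, g I := fun B hB =>
    if_pos (mem_powersetCard.1 hB).2
  have hAup := hup A (mem_powersetCard.2 ⟨subset_univ _, hA⟩)
  have hdisj : ∀ i, ({B ∈ powersetCard i univ | Disjoint A B} : Finset (Finset α)) =
      Aᶜ.powersetCard i := by
    intro i
    ext B
    simp [mem_powersetCard, subset_compl_iff_disjoint_left, and_comm]
  have h1 : ∑ B ∈ powersetCard k univ, (if Disjoint A B then 1 else 0) * upOperator j k g B =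
      (-1) ^ j * ((Fintype.card α - k - j).choose (k - j) : ℝ) * upOperator j k g A := by
    simp only [ite_mul, one_mul, zero_mul]
    rw [← sum_filter, sum_congr rfl fun B hB => hup B (mem_filter.1 hB).1, hdisj,
      sum_sum_powersetCard hjk, ← hdisj, hg.sum_disjoint, hAup, card_compl, hA]
    ring
  have h2 : ∑ B ∈ powersetCard k univ, c * upOperator j k g B =
      (if j = 0 then c * (Fintype.card α).choose k else 0) * upOperator j k g A := by
    rw [← mul_sum, sum_congr rfl hup, sum_sum_powersetCard hjk, hAup]
    split_ifs with hj
    · subst hj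
      simp [mul_assoc]
    · have := hg ∅ (by simpa using Nat.pos_of_ne_zero hj)
      simp only [empty_subset, filter_true] at this
      rw [this]
      simp
  simp only [hA, if_true, sub_mul, sum_sub_distrib]
  rw [h1, h2]
  ring

/-- The orthogonal splitting of a function at level `j` into a part lifted from lower levels and a
harmonic part. -/
theorem exists_harmonic_add (j : ℕ) (h : EuclideanSpace ℝ (Finset α)) :
    ∃ g, IsHarmonic j g ∧ ∃ u ∈ ⨆ i < j, LinearMap.range (upOperator (α := α) i j), h = u + g := by
  obtain ⟨u, hu, g, hg, rfl⟩ :=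
    (⨆ i < j, LinearMap.range (upOperator (α := α) i j)).exists_add_mem_mem_orthogonal h
  refine ⟨g, fun J hJ => ?_, u, hu, rfl⟩
  have hmem : upOperator #J j (EuclideanSpace.single J 1) ∈
      ⨆ i < j, LinearMap.range (upOperator (α := α) i j) :=
    Submodule.mem_iSup_of_mem #J (Submodule.mem_iSup_of_mem hJ ⟨_, rfl⟩)
  have h0 := hg _ hmem
  rw [PiLp.inner_apply] at h0
  rw [← h0, sum_filter]
  have : (powersetCard j univ : Finset (Finset α)) = univ.filter (fun A => #A = j) := by
    ext; simp [mem_powersetCard]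
  rw [this, sum_filter]
  refine sum_congr rfl fun I _ => ?_
  rw [upOperator_apply]
  split_ifs with h1 h2
  · simp [mem_powersetCard, h2]
  · simp [mem_powersetCard, h2]
  · simp

/-- The eigenvalues on lifts of harmonic functions are the whole spectrum of `M + t I - c J`, up to
the eigenvalue `0` of the functions that vanish on level `k`. The induction on `j` shows that all
lifts from level `j` to level `k` lie in the span of the eigenspaces considered. -/
theorem iSup_eigenspace_shiftedKneser (k : ℕ) {t c R : ℝ} (hR : 0 ≤ R)
    (hb : ∀ j ≤ k, |(-1) ^ j * ((Fintype.card α - k - j).choose (k - j) : ℝ) + t -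
        if j = 0 then c * (Fintype.card α).choose k else 0| ≤ R) :
    ⨆ μ ∈ {μ : ℝ | |μ| ≤ R}, Module.End.eigenspace (shiftedKneser (α := α) k t c) μ = ⊤ := by
  set W := ⨆ μ ∈ {μ : ℝ | |μ| ≤ R}, Module.End.eigenspace (shiftedKneser (α := α) k t c) μ with hW
  have hmem : ∀ μ f, |μ| ≤ R → shiftedKneser (α := α) k t c f = μ • f → f ∈ W := fun μ f h1 h2 =>
    Submodule.mem_iSup_of_mem μ (Submodule.mem_iSup_of_mem h1 (Module.End.mem_eigenspace_iff.2 h2))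
  have key : ∀ j ≤ k, ∀ h, upOperator (α := α) j k h ∈ W := by
    intro j
    induction j using Nat.strong_induction_on with
    | _ j ih =>
      intro hj h
      obtain ⟨g, hg, u, hu, rfl⟩ := exists_harmonic_add j h
      rw [map_add]
      refine W.add_mem ?_ (hmem _ _ (hb j hj) (shiftedKneser_upOperator hj t c hg))
      suffices hle : ⨆ i < j, LinearMap.range (upOperator (α := α) i j) ≤
          W.comap (upOperator j k) from hle hu
      refine iSup₂_le fun i hi => ?_
      rintro _ ⟨f, rfl⟩
      rw [Submodule.mem_comap, upOperator_comp hi.le]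
      exact W.smul_mem _ (ih i hi (hi.le.trans hj) f)
  rw [eq_top_iff]
  intro f _
  -- `upOperator k k` is the restriction to level `k`.
  rw [← sub_add_cancel f (upOperator k k f)]
  refine W.add_mem (hmem 0 _ (by simpa using hR) ?_) (key k le_rfl f)
  have hz : ∀ A : Finset α, #A = k → (f - upOperator k k f) A = 0 := by
    intro A hA
    rw [PiLp.sub_apply, upOperator_apply, if_pos hA]
    subst hA
    simp
  ext A
  rw [shiftedKneser_apply, zero_smul]
  split_ifs with hA
  · rw [hz A hA, sum_eq_zero fun B hB => by rw [hz B (mem_powersetCard.1 hB).2, mul_zero]]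
    simp
  · rfl

theorem abs_inner_shiftedKneser_le (k : ℕ) {t c R : ℝ} (hR : 0 ≤ R)
    (hb : ∀ j ≤ k, |(-1) ^ j * ((Fintype.card α - k - j).choose (k - j) : ℝ) + t -
        if j = 0 then c * (Fintype.card α).choose k else 0| ≤ R)
    (f g : EuclideanSpace ℝ (Finset α)) :
    |inner ℝ f (shiftedKneser k t c g)| ≤ R / 2 * (‖f‖ ^ 2 + ‖g‖ ^ 2) :=
  abs_inner_le_of_eigenvalues (isSymmetric_shiftedKneser k t c) (fun _ hμ =>
    mem_of_hasEigenvalue_of_iSup_eigenspace_eq_top (iSup_eigenspace_shiftedKneser k hR hb) hμ) f g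

/-! ### The ratio bound for cross-intersecting families -/

/-- The indicator function of a family of finite sets. -/
def familyIndicator {α : Type*} [DecidableEq α] (𝒜 : Finset (Finset α)) :
    EuclideanSpace ℝ (Finset α) :=
  WithLp.toLp 2 fun A => if A ∈ 𝒜 then 1 else 0

theorem familyIndicator_apply {α : Type*} [DecidableEq α] (𝒜 : Finset (Finset α))
    (A : Finset α) :
    familyIndicator 𝒜 A = if A ∈ 𝒜 then 1 else 0 := rfl

theorem norm_familyIndicator_sq (𝒜 : Finset (Finset α)) : ‖familyIndicator 𝒜‖ ^ 2 = #𝒜 := by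
  simp [EuclideanSpace.norm_sq_eq, familyIndicator_apply, apply_ite]

theorem inner_familyIndicator_shiftedKneser {k : ℕ} (t c : ℝ) {𝒜 ℬ : Finset (Finset α)}
    (h𝒜 : 𝒜 ⊆ powersetCard k univ) (hℬ : ℬ ⊆ powersetCard k univ)
    (hcross : CrossIntersecting 𝒜 ℬ) (hdisj : Disjoint 𝒜 ℬ) :
    inner ℝ (familyIndicator 𝒜) (shiftedKneser k t c (familyIndicator ℬ)) =
      -(c * (#𝒜 * #ℬ)) := by
  have hprod : ∀ A B, familyIndicator 𝒜 A * familyIndicator ℬ B =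
      if A ∈ 𝒜 then if B ∈ ℬ then 1 else 0 else 0 := by
    intro A B
    simp only [familyIndicator_apply]
    split_ifs <;> simp
  have h1 : ∑ A ∈ powersetCard k univ, familyIndicator 𝒜 A * familyIndicator ℬ A = 0 := by
    refine sum_eq_zero fun A _ => ?_
    rw [hprod]
    split_ifs with hA hB
    · exact absurd hB (disjoint_left.1 hdisj hA)
    · rfl
    · rfl
  have h2 : ∀ A B, ((if Disjoint A B then 1 else 0) - c) *
      (familyIndicator 𝒜 A * familyIndicator ℬ B) =
      -c * (familyIndicator 𝒜 A * familyIndicator ℬ B) := by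
    intro A B
    rw [hprod]
    split_ifs with hAB hA hB
    · exact absurd (disjoint_iff_inter_eq_empty.1 hAB) (hcross A hA B hB).ne_empty
    all_goals simp
  have h3 : ∀ {𝒞 : Finset (Finset α)}, 𝒞 ⊆ powersetCard k univ →
      ∑ A ∈ powersetCard k univ, familyIndicator 𝒞 A = #𝒞 := by
    intro 𝒞 h𝒞
    simp only [familyIndicator_apply]
    rw [← sum_filter, filter_mem_eq_inter, inter_eq_right.2 h𝒞]
    simp
  rw [inner_shiftedKneser, h1]
  simp only [h2]
  simp only [← mul_sum, ← sum_mul, h3 h𝒜, h3 hℬ]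
  ring

/-- The ratio bound: `R` bounds the spectrum of `M + t I - c J`, with `j = 0` the eigenvalue of the
constants, which alone is affected by `c`. -/
theorem card_mul_le_of_crossIntersecting {k : ℕ} {t c R : ℝ} (hR : 0 ≤ R)
    (hb : ∀ j ≤ k, |(-1) ^ j * ((Fintype.card α - k - j).choose (k - j) : ℝ) + t -
        if j = 0 then c * (Fintype.card α).choose k else 0| ≤ R)
    {𝒜 ℬ : Finset (Finset α)}
    (h𝒜 : 𝒜 ⊆ powersetCard k univ) (hℬ : ℬ ⊆ powersetCard k univ)
    (hcross : CrossIntersecting 𝒜 ℬ) (hdisj : Disjoint 𝒜 ℬ) (hcard : #𝒜 = #ℬ) :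
    c * #𝒜 ≤ R := by
  have h := abs_inner_shiftedKneser_le k hR hb (familyIndicator 𝒜) (familyIndicator ℬ)
  rw [inner_familyIndicator_shiftedKneser t c h𝒜 hℬ hcross hdisj, norm_familyIndicator_sq,
    norm_familyIndicator_sq, abs_neg, ← hcard] at h
  have h' := (le_abs_self _).trans h
  rcases (Nat.cast_nonneg (α := ℝ) #𝒜).eq_or_lt with h0 | h0
  · rw [← h0, mul_zero]
    exact hR
  · exact le_of_mul_le_mul_right (by linarith) h0

/-- With `m = n - k`, these are the eigenvalues of the Kneser graph on nonconstant lifts. The absolute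
values decrease with `j`, so the extreme ones are at `j = 1` (negative) and `j = 2` (positive). -/
theorem neg_one_pow_mul_choose_mem_Icc {m k j : ℕ} (hkm : k ≤ m) (hj : 1 ≤ j)
    (hjk : j ≤ k) :
    (-1) ^ j * ((m - j).choose (k - j) : ℝ) ∈
      Set.Icc (-((m - 1).choose (k - 1) : ℝ)) ((m - 2).choose (k - 2) : ℝ) := by
  have anti : ∀ a b, a ≤ b → b ≤ k → (m - b).choose (k - b) ≤ (m - a).choose (k - a) := by
    intro a b hab
    induction b, hab using Nat.le_induction with
    | base => exact fun _ => le_rfl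
    | succ b hab ih =>
      intro hb
      refine le_trans ?_ (ih (by omega))
      obtain ⟨p, hp⟩ : ∃ p, m - b = p + 1 := ⟨m - b - 1, by omega⟩
      obtain ⟨q, hq⟩ : ∃ q, k - b = q + 1 := ⟨k - b - 1, by omega⟩
      rw [hp, hq, show m - (b + 1) = p by omega, show k - (b + 1) = q by omega,
        Nat.choose_succ_succ]
      exact Nat.le_add_right _ _
  have h1 : ((m - j).choose (k - j) : ℝ) ≤ ((m - 1).choose (k - 1) : ℝ) := by
    exact_mod_cast anti 1 j hj hjk
  have h0 : (0 : ℝ) ≤ ((m - j).choose (k - j) : ℝ) := Nat.cast_nonneg _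
  have h2 : (0 : ℝ) ≤ ((m - 2).choose (k - 2) : ℝ) := Nat.cast_nonneg _
  rcases Nat.even_or_odd j with he | ho
  · have h3 : ((m - j).choose (k - j) : ℝ) ≤ ((m - 2).choose (k - 2) : ℝ) := by
      exact_mod_cast anti 2 j (by obtain ⟨r, rfl⟩ := he; omega) hjk
    rw [he.neg_one_pow, one_mul]
    exact ⟨by linarith, h3⟩
  · rw [ho.neg_one_pow, neg_one_mul]
    exact ⟨by linarith, by linarith⟩

/-- The value `R / c` of the ratio bound, in closed form. -/
theorem kneser_ratio_eq {n k : ℕ} (hk : 2 ≤ k) (hn : 2 * k ≤ n) :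
    (((n - k - 1).choose (k - 1) : ℝ) + ((n - k - 2).choose (k - 2) : ℝ)) / 2 * (n.choose k : ℝ) =
      (1 / 2 * ((n - 1).choose (k - 1) : ℝ) * (((n : ℝ) - 2) / ((n : ℝ) - k - 1))) *
        (((n - k).choose k : ℝ) + ((n - k - 1).choose (k - 1) : ℝ)) := by
  obtain ⟨p, rfl⟩ : ∃ p, k = p + 2 := ⟨k - 2, by omega⟩
  obtain ⟨q, rfl⟩ : ∃ q, n = q + (p + 2) + 2 := ⟨n - (p + 2) - 2, by omega⟩
  have e1 := Nat.add_one_mul_choose_eq (q + 1) (p + 1)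
  have e2 := Nat.add_one_mul_choose_eq q p
  have e3 := Nat.add_one_mul_choose_eq (q + (p + 2) + 1) (p + 1)
  rw [show q + (p + 2) + 2 - (p + 2) - 1 = q + 1 by omega,
    show q + (p + 2) + 2 - (p + 2) - 2 = q by omega,
    show q + (p + 2) + 2 - (p + 2) = q + 2 by omega,
    show q + (p + 2) + 2 - 1 = q + (p + 2) + 1 by omega,
    show p + 2 - 1 = p + 1 by omega, show p + 2 - 2 = p by omega]
  simp only [add_assoc, Nat.reduceAdd] at e1 e2 e3 ⊢
  have e1' := congrArg (Nat.cast : ℕ → ℝ) e1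
  have e2' := congrArg (Nat.cast : ℕ → ℝ) e2
  have e3' := congrArg (Nat.cast : ℕ → ℝ) e3
  push_cast at e1' e2' e3' ⊢
  generalize ((q + 1).choose (p + 1) : ℝ) = c1 at *
  generalize (q.choose p : ℝ) = c2 at *
  generalize ((q + 2).choose (p + 2) : ℝ) = d at *
  generalize ((q + (p + 3)).choose (p + 1) : ℝ) = b at *
  generalize ((q + (p + 4)).choose (p + 2) : ℝ) = N at *
  have hq : (q : ℝ) + 1 ≠ 0 := by positivity
  have hp : (p : ℝ) + 2 ≠ 0 := by positivity
  have hc2 : c2 = c1 * (p + 1) / (q + 1) := by field_simp; linarith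
  have hd : d = (q + 2) * c1 / (p + 2) := by field_simp; linarith
  have hN : N = (q + (p + 4)) * b / (p + 2) := by field_simp; linarith
  have hden : (q : ℝ) + (p + 4) - (p + 2) - 1 = q + 1 := by ring
  rw [hc2, hd, hN, hden]
  field_simp
  ring

theorem crossIntersecting_one_eq_empty {𝒜 ℬ : Finset (Finset α)}
    (h𝒜 : 𝒜 ⊆ powersetCard 1 univ) (hℬ : ℬ ⊆ powersetCard 1 univ)
    (hcross : CrossIntersecting 𝒜 ℬ) (hdisj : Disjoint 𝒜 ℬ) : 𝒜 = ∅ ∨ ℬ = ∅ := by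
  by_contra! h
  obtain ⟨⟨A, hA⟩, ⟨B, hB⟩⟩ := h
  obtain ⟨a, rfl⟩ := card_eq_one.1 (mem_powersetCard.1 (h𝒜 hA)).2
  obtain ⟨b, rfl⟩ := card_eq_one.1 (mem_powersetCard.1 (hℬ hB)).2
  obtain ⟨x, hx⟩ := hcross _ hA _ hB
  simp only [mem_inter, mem_singleton] at hx
  obtain ⟨rfl, rfl⟩ := hx
  exact disjoint_left.1 hdisj hA hB

theorem theorem2 (n k : ℕ) (hk : 1 ≤ k) (hn : 2 * k ≤ n)
    (𝒜 ℬ : Finset (Finset (Fin n)))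
    (h𝒜 : 𝒜 ⊆ Finset.powersetCard k Finset.univ)
    (hℬ : ℬ ⊆ Finset.powersetCard k Finset.univ)
    (hcross : CrossIntersecting 𝒜 ℬ) (hdisj : Disjoint 𝒜 ℬ) :
    min (𝒜.card : ℝ) (ℬ.card : ℝ) ≤
      1 / 2 * ((n - 1).choose (k - 1) : ℝ) * (((n : ℝ) - 2) / ((n : ℝ) - k - 1)) := by
  rcases hk.eq_or_lt with rfl | hk
  · -- Disjoint cross-intersecting families of singletons cannot both be nonempty.
    have hmin : min (#𝒜 : ℝ) (#ℬ : ℝ) ≤ 0 := by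
      rcases crossIntersecting_one_eq_empty h𝒜 hℬ hcross hdisj with rfl | rfl <;> simp
    have hn' : (2 : ℝ) ≤ n := by exact_mod_cast hn
    have h2 : (0 : ℝ) ≤ n - 2 := by linarith
    have h3 : (0 : ℝ) ≤ n - (1 : ℕ) - 1 := by push_cast; linarith
    exact hmin.trans (by positivity)
  -- The ratio bound needs families of the same size: shrink the larger one.
  obtain ⟨𝒜', hsub𝒜, hcard𝒜⟩ := exists_subset_card_eq (min_le_left #𝒜 #ℬ)
  obtain ⟨ℬ', hsubℬ, hcardℬ⟩ := exists_subset_card_eq (min_le_right #𝒜 #ℬ)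
  have hcross' : CrossIntersecting 𝒜' ℬ' := fun A hA B hB =>
    hcross A (hsub𝒜 hA) B (hsubℬ hB)
  have hN : (0 : ℝ) < n.choose k := by exact_mod_cast Nat.choose_pos (by omega)
  set C₁ : ℝ := ((n - k - 1).choose (k - 1) : ℝ) with hC₁
  set C₂ : ℝ := ((n - k - 2).choose (k - 2) : ℝ) with hC₂
  have hC₁pos : 0 < C₁ := Nat.cast_pos.2 (Nat.choose_pos (by omega))
  have hC₂nonneg : 0 ≤ C₂ := Nat.cast_nonneg _
  have hd : (0 : ℝ) ≤ (n - k).choose k := Nat.cast_nonneg _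
  have hbound := card_mul_le_of_crossIntersecting (α := Fin n) (k := k) (t := (C₁ - C₂) / 2)
    (c := (((n - k).choose k : ℝ) + C₁) / n.choose k) (R := (C₁ + C₂) / 2) (by positivity) ?_
    (hsub𝒜.trans h𝒜) (hsubℬ.trans hℬ) hcross' (hdisj.mono hsub𝒜 hsubℬ) (hcard𝒜.trans hcardℬ.symm)
  · rw [hcard𝒜, Nat.cast_min, div_mul_eq_mul_div, div_le_iff₀ hN, kneser_ratio_eq hk hn,
      mul_comm (_ + _)] at hbound
    exact le_of_mul_le_mul_right hbound (by positivity)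
  · intro j hj
    rw [Fintype.card_fin, abs_le]
    split_ifs with h0
    · subst h0
      rw [div_mul_cancel₀ _ hN.ne']
      simp only [pow_zero, one_mul, Nat.sub_zero]
      constructor <;> linarith
    · have h := neg_one_pow_mul_choose_mem_Icc (m := n - k) (by omega)
        (Nat.one_le_iff_ne_zero.2 h0) hj
      constructor <;> linarith [h.1, h.2]
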